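/- A \emph{space} is a simplicial set, and a \emph{simplicial space} is a simplicial object $W=(W_n)_{n\ge 0}$ in simplicial sets. For simplicial spaces $X,Y$ let $\mathrm{Map}(X,Y)$ be the space whose $n$-simplices are the maps $X\times\Delta[n]\to Y$ of simplicial spaces. Let $F(k)$ be the simplicial space whose $n$-th space is the discrete space of monotone maps $[n]\to[k]$ (so $\mathrm{Map}(F(k),W)\cong W_k$), let $\dot F(k)\subset F(k)$ be the largest subobject not containing $\mathrm{id}_{[k]}$, and let $G(k)\subset F(k)$ be the smallest subobject containing all maps $[0]\to[k]$ and the maps $\alpha^i\colon[1]\to[k]$, $j\mapsto i+j$, for $0\le i<k$ (so $\mathrm{Map}(G(k),W)\cong W_1\times_{W_0}\cdots\times_{W_0}W_1$ for $k\geq 1$). A simplicial space $W$ is a \emph{Segal space} if it is Reedy fibrant, i.e. $\mathrm{Map}(F(k),W)\to\mathrm{Map}(\dot F(k),W)$ is a Kan fibration for every $k\ge0$, and if $\mathrm{Map}(F(k),W)\to\mathrm{Map}(G(k),W)$ is a weak equivalence for every $k\geq 0$. For points $x,y$ of $W_0$ let $\mathrm{map}_W(x,y)$ be the fibre of $(d_1,d_0)\colon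 W_1\to W_0\times W_0$ over $(x,y)$, and let $\mathrm{id}_x=s_0x$. Two points of $\mathrm{map}_W(x,y)$ are homotopic ($\sim$) if they lie in the same component of $\mathrm{map}_W(x,y)$. A point $d_1k$ of $\mathrm{map}_W(x,z)$ is a composite $g\circ f$ of $f\in\mathrm{map}_W(x,y)$ and $g\in\mathrm{map}_W(y,z)$ if $k$ is a point of $W_2$ with $d_2k=f$ and $d_0k=g$. A point $g\in\mathrm{map}_W(x,y)$ is a \emph{homotopy equivalence} if there are $f,h\in\mathrm{map}_W(y,x)$ with $g\circ f\sim\mathrm{id}_y$ and $h\circ g\sim\mathrm{id}_x$. Let $W_{\mathrm{hoequiv}}\subseteq W_1$ be the subspace consisting of exactly those components whose points are homotopy equivalences. A Segal space $W$ is a \emph{complete Segal space} if $s_0\colon W_0\to W_1$, which factors through $W_{\mathrm{hoequiv}}$, induces a weak equivalence $W_0\to W_{\mathrm{hoequiv}}$. The \emph{classifying diagram} $NC$ of a category $C$ is the simplicial space with $(NC)_m=\mathrm{nerve}\,\mathrm{iso}(C^{[m]})$, the nerve of the maximal subgroupoid of the category of functors $[m]\to C$, with structure maps given by restriction along monotone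 maps. \textbf{Proposition.} If $C$ is a small category, then its classifying diagram $NC$ is a complete Segal space. That is, $NC$ is Reedy fibrant, the maps $(NC)_k\to (NC)_1\times_{(NC)_0}\cdots\times_{(NC)_0}(NC)_1$ are weak equivalences, and $s_0\colon(NC)_0\to(NC)_{\mathrm{hoequiv}}$ is (well defined and) a weak equivalence. -/

import Mathlib

open CategoryTheory MonoidalCategory Opposite Simplicial

universe u v w

namespace RezkSpace

/-! ### Weak equivalences of simplicial sets -/

/-- Two maps `f g : X ⟶ K` of simplicial sets are simplicially homotopic if there is a map
`X × Δ[1] ⟶ K` which restricts to `f` and `g` at the two ends of `Δ[1]`. -/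
def SimpliciallyHomotopic {X K : SSet.{w}} (f g : X ⟶ K) : Prop :=
  ∃ H : X ⊗ Δ[1] ⟶ K, SSet.ι₀ ≫ H = f ∧ SSet.ι₁ ≫ H = g

/-- The set `[X, K]` of homotopy classes of maps `X ⟶ K` of simplicial sets: the quotient of
`X ⟶ K` by the equivalence relation generated by simplicial homotopy
(equivalently, the connected components of the mapping space from `X` to `K`). -/
def HomotopyClasses (X K : SSet.{w}) : Type w :=
  Quot (SimpliciallyHomotopic (X := X) (K := K))

/-- Homotopies can be precomposed. -/
lemma SimpliciallyHomotopic.precomp {X Y K : SSet.{w}} (f : X ⟶ Y) {g h : Y ⟶ K}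
    (H : SimpliciallyHomotopic g h) : SimpliciallyHomotopic (f ≫ g) (f ≫ h) := by
  obtain ⟨H, e₀, e₁⟩ := H
  refine ⟨f ▷ _ ≫ H, ?_, ?_⟩
  · rw [SSet.ι₀_comp_assoc, e₀]
  · rw [SSet.ι₁_comp_assoc, e₁]

/-- The map `[Y, K] → [X, K]` of precomposition with `f : X ⟶ Y`. -/
def HomotopyClasses.precomp {X Y : SSet.{w}} (f : X ⟶ Y) (K : SSet.{w}) :
    HomotopyClasses Y K → HomotopyClasses X K :=
  Quot.map (fun g => f ≫ g) (fun _ _ H => H.precomp f)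

/-- A map `f : X ⟶ Y` of simplicial sets is a weak (homotopy) equivalence if for every Kan
complex `K` the map `[Y, K] → [X, K]` is a bijection. -/
def IsWeakEquivalence {X Y : SSet.{w}} (f : X ⟶ Y) : Prop :=
  ∀ K : SSet.{w}, SSet.KanComplex K → Function.Bijective (HomotopyClasses.precomp f K)

/-- Kan fibrations: the maps with the right lifting property with respect to all horn
inclusions `Λ[n, i] ⟶ Δ[n]`, `n ≥ 1`, `0 ≤ i ≤ n`. -/
def IsKanFibration {X Y : SSet.{w}} (f : X ⟶ Y) : Prop :=
  SSet.modelCategoryQuillen.J.rlp f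

/-! ### Simplicial spaces -/

/-- A simplicial space is a simplicial object in simplicial sets ("spaces"). -/
abbrev SimplicialSpace : Type (w + 1) := SimplicialObject SSet.{w}

/-- For a simplicial space `X`, the functor sending a space `K` to the simplicial space
`X × K`, `n ↦ X_n × K`. -/
def timesSpace (X : SimplicialSpace.{w}) : SSet.{w} ⥤ SimplicialSpace.{w} :=
  tensoringRight SSet.{w} ⋙ (Functor.whiskeringLeft _ _ _).obj X

/-- A map `X ⟶ Y` of simplicial spaces induces `X × K ⟶ Y × K`, naturally in the space `K`. -/
def timesSpaceMap {X Y : SimplicialSpace.{w}} (i : X ⟶ Y) : timesSpace X ⟶ timesSpace Y :=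
  Functor.whiskerLeft (tensoringRight SSet.{w}) ((Functor.whiskeringLeft _ _ _).map i)

/-- The mapping space `Map(X, Y)` between simplicial spaces: its `n`-simplices are the maps
`X × Δ[n] ⟶ Y` of simplicial spaces. -/
def mapSpace (X Y : SimplicialSpace.{w}) : SSet.{w} :=
  (SSet.stdSimplex.{w} ⋙ timesSpace X).op ⋙ yoneda.obj Y

/-- Restriction `Map(Y, W) ⟶ Map(X, W)` along `i : X ⟶ Y`. -/
def mapSpacePrecomp {X Y : SimplicialSpace.{w}} (i : X ⟶ Y) (W : SimplicialSpace.{w}) :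
    mapSpace Y W ⟶ mapSpace X W :=
  Functor.whiskerRight (NatTrans.op (Functor.whiskerLeft SSet.stdSimplex.{w} (timesSpaceMap i)))
    (yoneda.obj W)

/-- A simplicial set `K` regarded as a discrete simplicial space: the `n`-th space is the set
`K_n`, regarded as a discrete (constant) simplicial set. -/
def discrete : SSet.{w} ⥤ SimplicialSpace.{w} :=
  (Functor.whiskeringRight _ _ _).obj (Functor.const SimplexCategoryᵒᵖ)

/-- `F(k)`: the `n`-th space is the discrete space of monotone maps `[n] → [k]`. -/
abbrev F (k : ℕ) : SimplicialSpace.{w} := discrete.obj Δ[k]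

/-- The inclusion into `F(k)` of the largest subobject that does not contain the identity of
`[k]`; it consists of the non-surjective maps `[n] → [k]`. -/
def boundaryInclusion (k : ℕ) :
    discrete.obj ((SSet.boundary.{w} k : Δ[k].Subcomplex) : SSet.{w}) ⟶ F.{w} k :=
  discrete.map (SSet.boundary k).ι

/-- A simplicial space is Reedy fibrant if for every `k ≥ 0` the restriction map
from `Map(F(k), W)` to the mapping space out of the boundary of `F(k)` is a Kan fibration. -/
def IsReedyFibrant (W : SimplicialSpace.{w}) : Prop :=
  ∀ k : ℕ, IsKanFibration (mapSpacePrecomp (boundaryInclusion k) W)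

/-- The edge `α^i : [1] → [k]`, `j ↦ i + j`, of the standard simplex. -/
def alpha {k : ℕ} (i : Fin k) : (Δ[k] : SSet.{w}) _⦋1⦌ :=
  SSet.stdSimplex.edge k i.castSucc i.succ i.castSucc_lt_succ.le

/-- The smallest subcomplex of `Δ[k]` that contains all vertices and the edges
`α^0, …, α^{k-1}`. -/
def spine (k : ℕ) : (Δ[k] : SSet.{w}).Subcomplex :=
  (⨆ x : (Δ[k] : SSet.{w}) _⦋0⦌, SSet.Subcomplex.ofSimplex x) ⊔
    ⨆ i : Fin k, SSet.Subcomplex.ofSimplex (alpha i)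

/-- The inclusion `φ^k : G(k) ⟶ F(k)` of the smallest subobject that contains the vertices and
the edges `α^i`. -/
def spineInclusion (k : ℕ) : discrete.obj (spine.{w} k : SSet.{w}) ⟶ F.{w} k :=
  discrete.map (spine k).ι

/-- A Segal space is a Reedy fibrant simplicial space for which the maps
`Map(F(k), W) ⟶ Map(G(k), W)`, that is `W_k ⟶ W_1 ×_{W_0} ⋯ ×_{W_0} W_1`, are weak
equivalences. -/
structure IsSegalSpace (W : SimplicialSpace.{w}) : Prop where
  reedyFibrant : IsReedyFibrant W
  segal : ∀ k : ℕ, IsWeakEquivalence (mapSpacePrecomp (spineInclusion k) W)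

/-! ### Homotopy equivalences in a simplicial space -/

/-- The objects of `W` are the points of the space `W_0`. -/
abbrev Ob (W : SimplicialSpace.{w}) : Type w := (W _⦋0⦌ : SSet.{w}) _⦋0⦌

/-- The mapping space `map_W(x, y)`: the fibre of `(d_1, d_0) : W_1 ⟶ W_0 × W_0` over
`(x, y)`, as a subspace of `W_1`. -/
def hom (W : SimplicialSpace.{w}) (x y : Ob W) : (W _⦋1⦌ : SSet.{w}).Subcomplex :=
  (SSet.Subcomplex.ofSimplex x).preimage (W.δ (1 : Fin 2)) ⊓
    (SSet.Subcomplex.ofSimplex y).preimage (W.δ (0 : Fin 2))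

/-- The points of `map_W(x, y)`. -/
abbrev Hom (W : SimplicialSpace.{w}) (x y : Ob W) : Type w :=
  ((hom W x y : (W _⦋1⦌ : SSet.{w}).Subcomplex) : SSet.{w}) _⦋0⦌

/-- Two points of `map_W(x, y)` are homotopic if they lie in the same component of it. -/
def Homotopic {W : SimplicialSpace.{w}} {x y : Ob W} (f g : Hom W x y) : Prop :=
  SSet.π₀.mk f = SSet.π₀.mk g

/-- `h` is the result of a composition of `f` and `g`: there is a point `k` of `W_2` with
`d_2 k = f`, `d_0 k = g` and `d_1 k = h`. -/
def IsComposition {W : SimplicialSpace.{w}} {x y z : Ob W} (f : Hom W x y) (g : Hom W y z)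
    (h : Hom W x z) : Prop :=
  ∃ k : (W _⦋2⦌ : SSet.{w}) _⦋0⦌,
    (W.δ (2 : Fin 3)).app _ k = f.1 ∧ (W.δ (0 : Fin 3)).app _ k = g.1 ∧
      (W.δ (1 : Fin 3)).app _ k = h.1

/-- The point `s_0 x` of `W_1` lies in `map_W(x, x)`. -/
lemma id_mem (W : SimplicialSpace.{w}) (x : Ob W) :
    (W.σ (0 : Fin 1)).app _ x ∈ (hom W x x).obj (op ⦋0⦌) := by
  have h₁ : (W.δ (1 : Fin 2)).app (op ⦋0⦌) ((W.σ (0 : Fin 1)).app _ x) = x :=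
    ConcreteCategory.congr_hom (congr_app (W.δ_comp_σ_succ (i := (0 : Fin 1))) (op ⦋0⦌)) x
  have h₀ : (W.δ (0 : Fin 2)).app (op ⦋0⦌) ((W.σ (0 : Fin 1)).app _ x) = x :=
    ConcreteCategory.congr_hom (congr_app (W.δ_comp_σ_self (i := (0 : Fin 1))) (op ⦋0⦌)) x
  refine ⟨?_, ?_⟩
  · change (W.δ (1 : Fin 2)).app (op ⦋0⦌) ((W.σ (0 : Fin 1)).app _ x) ∈
      (SSet.Subcomplex.ofSimplex x).obj (op ⦋0⦌)
    rw [h₁]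
    exact SSet.Subcomplex.mem_ofSimplex_obj x
  · change (W.δ (0 : Fin 2)).app (op ⦋0⦌) ((W.σ (0 : Fin 1)).app _ x) ∈
      (SSet.Subcomplex.ofSimplex x).obj (op ⦋0⦌)
    rw [h₀]
    exact SSet.Subcomplex.mem_ofSimplex_obj x

/-- The identity map `id_x = s_0 x` of the object `x`, a point of `map_W(x, x)`. -/
def idHom (W : SimplicialSpace.{w}) (x : Ob W) : Hom W x x :=
  ⟨(W.σ (0 : Fin 1)).app _ x, id_mem W x⟩

/-- A point `g` of `map_W(x, y)` is a homotopy equivalence if there are points `f` and `h` of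
`map_W(y, x)` with `g ∘ f ∼ id_y` and `h ∘ g ∼ id_x`, where `g ∘ f` and `h ∘ g` are results of
compositions (in a Segal space compositions exist, and all results are homotopic). -/
def IsHoEquiv {W : SimplicialSpace.{w}} {x y : Ob W} (g : Hom W x y) : Prop :=
  (∃ (f : Hom W y x) (gf : Hom W y y), IsComposition f g gf ∧ Homotopic gf (idHom W y)) ∧
    ∃ (h : Hom W y x) (hg : Hom W x x), IsComposition g h hg ∧ Homotopic hg (idHom W x)

/-- A point of `W_1` is a homotopy equivalence if it is one in the mapping space
`map_W(x, y)` that contains it (namely for `x = d_1 g` and `y = d_0 g`). -/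
def IsHoEquivPoint (W : SimplicialSpace.{w}) (g : (W _⦋1⦌ : SSet.{w}) _⦋0⦌) : Prop :=
  ∃ (x y : Ob W) (hg : g ∈ (hom W x y).obj (op ⦋0⦌)), IsHoEquiv (W := W) (x := x) (y := y) ⟨g, hg⟩

/-- The space of homotopy equivalences: the subspace of `W_1` that consists of exactly those
components whose points are homotopy equivalences. A simplex `s` of `W_1` belongs to it if all
points in the component of `W_1` that contains (the vertices of) `s` are homotopy
equivalences. -/
def hoequiv (W : SimplicialSpace.{w}) : (W _⦋1⦌ : SSet.{w}).Subcomplex where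
  obj n := {s | ∀ (i : op n.unop ⟶ op ⦋0⦌) (g : (W _⦋1⦌ : SSet.{w}) _⦋0⦌),
    SSet.π₀.mk g = SSet.π₀.mk ((W _⦋1⦌ : SSet.{w}).map i s) → IsHoEquivPoint W g}
  map {m n} θ s hs i g hg := hs (θ ≫ i) g (by
    rw [hg]
    exact congrArg SSet.π₀.mk (ConcreteCategory.congr_hom
      ((W _⦋1⦌ : SSet.{w}).map_comp θ i) s).symm)

/-- A complete Segal space is a Segal space `W` such that `s_0 : W_0 ⟶ W_1`, which factors
(necessarily uniquely) through the space of homotopy equivalences, is a weak equivalence from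
`W_0` to the space of homotopy equivalences. -/
structure IsCompleteSegalSpace (W : SimplicialSpace.{w}) : Prop extends IsSegalSpace W where
  complete : ∃ s : W _⦋0⦌ ⟶ (hoequiv W : SSet.{w}),
    s ≫ (hoequiv W).ι = W.σ (0 : Fin 1) ∧ IsWeakEquivalence s

/-! ### The classifying diagram -/

/-- The restriction functor `iso(C^[m]) ⥤ iso(C^[n])` along a monotone map `[n] → [m]`. -/
def isoRestrict (C : Type u) [Category.{v} C] {m n : SimplexCategory} (θ : n ⟶ m) :
    Core (ComposableArrows C m.len) ⥤ Core (ComposableArrows C n.len) :=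
  ((Functor.whiskeringLeft _ _ C).obj (SimplexCategory.toCat.map θ).toFunctor).core

/-- The classifying diagram `NC` of a category `C`: its `m`-th space is the nerve of the maximal
subgroupoid of the category `C^[m]` of functors `[m] ⥤ C`. -/
def classifyingDiagram (C : Type u) [Category.{v} C] : SimplicialSpace.{max u v} where
  obj m := nerve (Core (ComposableArrows C m.unop.len))
  map θ := nerveMap (isoRestrict C θ.unop)
  map_id _ := rfl
  map_comp _ _ := rfl

end RezkSpace

/-! A simplicial space is a bisimplicial set, and `NC` is a nerve in both directions. Its columns
are nerves of groupoids. Its `n`-th row is the nerve of `IsoChains C n`: chains of `n` isomorphisms,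
with arbitrary natural transformations in `C` as morphisms. Since `Map(discrete K, W)` has as
`n`-simplices the maps from `K` to the `n`-th row, each axiom becomes a statement about rows or
columns. The Segal maps are even isomorphisms, because nerves are strict Segal
(`spine_precomp_bijective`). For Reedy fibrancy, horns of dimension at least two have unique fillers
in the nerve of a groupoid (`horn_precomp_bijective`), and unique filling in the columns passes to
the mapping spaces. For one-dimensional horns, lifting transposes to lifting the boundary inclusion
of `Δ[k]` against a map from row `1` to row `0`. That map is the nerve of a fully faithful functor
that is surjective on objects, so lifts exist (`nerveMap_hasLiftingProperty_boundary`). For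
completeness, an arrow of `C` is a homotopy equivalence exactly when it is an isomorphism
(`isHoEquivPoint_iff`). So the space of homotopy equivalences is the nerve of the groupoid of
isomorphisms, which deformation retracts onto the identities by contracting each isomorphism to its
source. -/

namespace RezkSpace

/-! ### Mapping spaces out of discrete simplicial spaces -/

section MapSpace

variable (W : SimplicialSpace.{w})

/-- The simplicial space with the two simplicial directions exchanged: `n ↦ (m ↦ (W_m)_n)`. -/
abbrev flipSpace : SimplicialSpace.{w} := Functor.flip W

/-- The simplicial set whose `n`-simplices are the maps from `K` to the `n`-th row of `W`. -/
def rowMaps (K : SSet.{w}) : SSet.{w} := flipSpace W ⋙ coyoneda.obj (op K)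

/-- Restriction of row maps along `i : K ⟶ L`. -/
def rowMapsPrecomp {K L : SSet.{w}} (i : K ⟶ L) : rowMaps W L ⟶ rowMaps W K :=
  Functor.whiskerLeft (flipSpace W) (coyoneda.map i.op)

variable {W}

/-- The simplex `(x, id)` of `discrete K × Δ[n]`. -/
def genericSimplex {K : SSet.{w}} (n : SimplexCategoryᵒᵖ) {m : SimplexCategoryᵒᵖ} (x : K.obj m) :
    ((((timesSpace (discrete.obj K)).obj (SSet.stdSimplex.obj n.unop)).obj m).obj n : Type w) :=
  show K.obj m × (SSet.stdSimplex.obj n.unop).obj n from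
    (x, SSet.stdSimplex.objEquiv.symm (𝟙 n.unop))

/-- The row map given by a map from `discrete K × Δ[n]` to `W`. -/
def toRowMap {K : SSet.{w}} {n : SimplexCategoryᵒᵖ}
    (f : (timesSpace (discrete.obj K)).obj (SSet.stdSimplex.obj n.unop) ⟶ W) :
    K ⟶ (flipSpace W).obj n where
  app m := ↾fun x => (f.app m).app n (genericSimplex n x)
  naturality m m' θ := by
    ext x
    exact ConcreteCategory.congr_hom (congr_app (f.naturality θ) n) (genericSimplex n x)

/-- The map from `discrete K × Δ[n]` to `W` given by a row map. -/
def ofRowMap {K : SSet.{w}} {n : SimplexCategoryᵒᵖ} (g : K ⟶ (flipSpace W).obj n) :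
    (timesSpace (discrete.obj K)).obj (SSet.stdSimplex.obj n.unop) ⟶ W where
  app m :=
    { app p := ↾fun (x : K.obj m × (SSet.stdSimplex.obj n.unop).obj p) =>
        (W.obj m).map (SSet.stdSimplex.objEquiv x.2).op (g.app m x.1)
      naturality p p' θ := by
        ext (x : K.obj m × (SSet.stdSimplex.obj n.unop).obj p)
        exact ConcreteCategory.congr_hom
          ((W.obj m).map_comp (SSet.stdSimplex.objEquiv x.2).op θ) (g.app m x.1) }
  naturality m m' θ := by
    apply SSet.hom_ext
    intro p
    ext (x : K.obj m × (SSet.stdSimplex.obj n.unop).obj p)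
    have h₁ := ConcreteCategory.congr_hom (g.naturality θ) x.1
    have h₂ := ConcreteCategory.congr_hom
      ((W.map θ).naturality (SSet.stdSimplex.objEquiv x.2).op) (g.app m x.1)
    exact (congrArg ((W.obj m').map (SSet.stdSimplex.objEquiv x.2).op) h₁).trans h₂.symm

/-- Maps from `discrete K × Δ[n]` to `W` are maps from `K` to the `n`-th row of `W`. -/
def rowMapsEquiv (K : SSet.{w}) (n : SimplexCategoryᵒᵖ) :
    (mapSpace (discrete.obj K) W).obj n ≃ (K ⟶ (flipSpace W).obj n) where
  toFun f := toRowMap f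
  invFun g := ofRowMap g
  left_inv f := by
    apply NatTrans.ext; funext m; apply SSet.hom_ext; intro p
    ext (x : K.obj m × (SSet.stdSimplex.obj n.unop).obj p)
    -- Yoneda argument: every simplex `(x, θ)` of `discrete K × Δ[n]` is the restriction along `θ`
    -- of the generic simplex `(x, id)`.
    have h := ConcreteCategory.congr_hom
      ((f.app m).naturality (SSet.stdSimplex.objEquiv x.2).op) (genericSimplex n x.1)
    have e : ((timesSpace (discrete.obj K)).obj (SSet.stdSimplex.obj n.unop) |>.obj m).map
        (SSet.stdSimplex.objEquiv x.2).op (genericSimplex n x.1) = x :=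
      Prod.ext rfl (SSet.stdSimplex.objEquiv.injective
        (show SSet.stdSimplex.objEquiv x.2 ≫ 𝟙 n.unop = _ from Category.comp_id _))
    exact h.symm.trans (congrArg ((f.app m).app p) e)
  right_inv g := by
    apply SSet.hom_ext; intro m; ext x
    exact ConcreteCategory.congr_hom ((W.obj m).map_id n) (g.app m x)

/-- `Map(discrete K, W)` is the simplicial set of row maps. -/
def rowMapsIso (W : SimplicialSpace.{w}) (K : SSet.{w}) :
    mapSpace (discrete.obj K) W ≅ rowMaps W K :=
  NatIso.ofComponents (fun n => (rowMapsEquiv K n).toIso) (fun {n n'} θ => by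
    ext (f : (timesSpace (discrete.obj K)).obj (SSet.stdSimplex.obj n.unop) ⟶ W)
    apply SSet.hom_ext; intro m; ext x
    exact ConcreteCategory.congr_hom ((f.app m).naturality θ) (genericSimplex n x))

/-- Restriction along `discrete.map i` is restriction of row maps along `i`. -/
lemma rowMapsIso_naturality (W : SimplicialSpace.{w}) {K L : SSet.{w}} (i : K ⟶ L) :
    mapSpacePrecomp (discrete.map i) W ≫ (rowMapsIso W K).hom =
      (rowMapsIso W L).hom ≫ rowMapsPrecomp W i := rfl

/-- `mapSpacePrecomp (discrete.map i)` and `rowMapsPrecomp i` are isomorphic arrows. -/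
def rowMapsArrowIso (W : SimplicialSpace.{w}) {K L : SSet.{w}} (i : K ⟶ L) :
    Arrow.mk (mapSpacePrecomp (discrete.map i) W) ≅ Arrow.mk (rowMapsPrecomp W i) :=
  Arrow.isoMk (rowMapsIso W L) (rowMapsIso W K) (rowMapsIso_naturality W i).symm

end MapSpace

lemma app_map {X Y : SSet.{w}} (f : X ⟶ Y) {m n : SimplexCategoryᵒᵖ} (θ : m ⟶ n)
    (x : X.obj m) : f.app n (X.map θ x) = Y.map θ (f.app m x) :=
  ConcreteCategory.congr_hom (f.naturality θ) x

/-! ### Strict Segal simplicial sets and spines -/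

section StrictSegal

/-- Maps into a strict Segal simplicial set which agree on `1`-simplices are equal. -/
lemma hom_ext_of_isStrictSegal {X Y : SSet.{w}} [Y.IsStrictSegal] {f g : X ⟶ Y}
    (h : ∀ x : X _⦋1⦌, f.app _ x = g.app _ x) : f = g := by
  -- A vertex is a face of its degenerate edge, so agreement on edges forces agreement on vertices.
  have h₀ : ∀ x : X _⦋0⦌, f.app _ x = g.app _ x := fun x => by
    have e : X.δ (0 : Fin 2) (X.σ 0 x) = x :=
      ConcreteCategory.congr_hom (X.δ_comp_σ_self (i := (0 : Fin 1))) x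
    rw [← e]
    exact (app_map f _ _).trans ((congrArg (Y.map _) (h _)).trans (app_map g _ _).symm)
  apply SSet.hom_ext
  rintro ⟨⟨m⟩⟩
  ext x
  apply (SSet.IsStrictSegal.segal m).injective
  apply SSet.Path.ext
  · funext i
    exact (app_map f _ x).symm.trans ((h₀ _).trans (app_map g _ x))
  · funext i
    exact (app_map f _ x).symm.trans ((h _).trans (app_map g _ x))

lemma vertex_mem_spine {k : ℕ} (x : (Δ[k] : SSet.{w}) _⦋0⦌) : x ∈ (spine k).obj (op ⦋0⦌) := by
  refine Or.inl ?_
  simp only [Subfunctor.iSup_obj, Set.mem_iUnion]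
  exact ⟨x, SSet.Subcomplex.mem_ofSimplex_obj x⟩

lemma alpha_mem_spine {k : ℕ} (i : Fin k) : (alpha.{w} i) ∈ (spine k).obj (op ⦋1⦌) := by
  refine Or.inr ?_
  simp only [Subfunctor.iSup_obj, Set.mem_iUnion]
  exact ⟨i, SSet.Subcomplex.mem_ofSimplex_obj _⟩

lemma spineId_arrow {k : ℕ} (i : Fin k) :
    (SSet.stdSimplex.spineId.{w} k).arrow i = alpha i := by
  ext j
  fin_cases j <;> rfl

/-- The tautological path in the spine. -/
def spinePath (k : ℕ) : SSet.Path (spine.{w} k : SSet.{w}) k :=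
  (spine k).liftPath (SSet.stdSimplex.spineId k) (fun _ => vertex_mem_spine _)
    (fun i => by rw [spineId_arrow]; exact alpha_mem_spine i)

/-- Maps out of the spine are determined by the image of the tautological path. -/
lemma spine_hom_ext {k : ℕ} {Y : SSet.{w}} {f g : (spine.{w} k : SSet.{w}) ⟶ Y}
    (h : (spinePath k).map f = (spinePath k).map g) : f = g := by
  apply SSet.hom_ext
  rintro ⟨⟨m⟩⟩
  ext ⟨x, hx⟩
  obtain hx | hx := hx
  · simp only [Subfunctor.iSup_obj, Set.mem_iUnion] at hx
    obtain ⟨y, z, rfl⟩ := hx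
    have h' := SSet.Path.congr_vertex h (SSet.stdSimplex.obj₀Equiv y)
    have e : (spinePath.{w} k).vertex (SSet.stdSimplex.obj₀Equiv y) =
        ⟨y, vertex_mem_spine y⟩ := Subtype.ext (SSet.stdSimplex.obj₀Equiv.symm_apply_apply y)
    rw [SSet.Path.map_vertex, SSet.Path.map_vertex, e] at h'
    exact (app_map f _ _).trans ((congrArg (Y.map _) h').trans (app_map g _ _).symm)
  · simp only [Subfunctor.iSup_obj, Set.mem_iUnion] at hx
    obtain ⟨i, z, rfl⟩ := hx
    have h' := SSet.Path.congr_arrow h i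
    have e : (spinePath.{w} k).arrow i = ⟨alpha i, alpha_mem_spine i⟩ :=
      Subtype.ext (spineId_arrow i)
    rw [SSet.Path.map_arrow, SSet.Path.map_arrow, e] at h'
    exact (app_map f _ _).trans ((congrArg (Y.map _) h').trans (app_map g _ _).symm)

/-- Maps from the spine to a strict Segal simplicial set extend uniquely to the simplex. -/
lemma spine_precomp_bijective (k : ℕ) (Y : SSet.{w}) [Y.IsStrictSegal] :
    Function.Bijective (fun f : Δ[k] ⟶ Y => (spine k).ι ≫ f) := by
  -- Under Yoneda, restriction to the spine becomes the Segal map of `Y`, whose bijectivity gives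
  -- both halves.
  have key (f : Δ[k] ⟶ Y) : (spinePath k).map ((spine k).ι ≫ f) =
      Y.spine k (SSet.yonedaEquiv f) := by
    obtain ⟨s, rfl⟩ := SSet.yonedaEquiv.symm.surjective f
    rw [Equiv.apply_symm_apply]
    apply SSet.Path.ext <;> rfl
  constructor
  · intro f g h
    apply SSet.yonedaEquiv.injective
    apply (SSet.IsStrictSegal.segal k).injective
    rw [← key, ← key]
    exact congrArg _ h
  · intro f
    obtain ⟨s, hs⟩ := (SSet.IsStrictSegal.segal (X := Y) k).surjective ((spinePath k).map f)
    refine ⟨SSet.yonedaEquiv.symm s, spine_hom_ext ?_⟩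
    dsimp only
    rw [key, Equiv.apply_symm_apply, hs]

end StrictSegal

/-! ### Maps from subcomplexes of simplices to nerves -/

section Nerve

variable {D : Type u} [Category.{v} D]

/-- A functor `[k] ⥤ D`, viewed as a simplex of the nerve, restricts to a given map on a
subcomplex if it does on `1`-simplices. -/
lemma nerve_extension {k : ℕ} (A : (Δ[k] : SSet.{max u v}).Subcomplex)
    (φ : (A : SSet.{max u v}) ⟶ nerve D) (F : ComposableArrows D k)
    (h : ∀ (x : (Δ[k] : SSet.{max u v}) _⦋1⦌) (hx : x ∈ A.obj _), φ.app _ ⟨x, hx⟩ =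
      ComposableArrows.mk₁ (F.map (homOfLE (SSet.stdSimplex.monotone_apply x (Fin.zero_le 1))))) :
    A.ι ≫ SSet.yonedaEquiv.symm (F : (nerve D) _⦋k⦌) = φ := by
  apply hom_ext_of_isStrictSegal
  rintro ⟨x, hx⟩
  rw [h x hx]
  exact ComposableArrows.ext₁ rfl rfl ((Category.id_comp _).trans (Category.comp_id _)).symm

end Nerve

/-! ### Lifting boundaries along fully faithful functors -/

section NerveMor

variable {D : Type u} [Category.{v} D]

/-- The object assigned to a vertex by a map to a nerve. -/
def nerveOb {X : SSet.{max u v}} (φ : X ⟶ nerve D) (x : X _⦋0⦌) : D :=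
  nerveEquiv (φ.app _ x)

/-- The morphism assigned to an edge by a map to a nerve. -/
def nerveMor {X : SSet.{max u v}} (φ : X ⟶ nerve D) {x y : X _⦋0⦌} (e : X.Edge x y) :
    nerveOb φ x ⟶ nerveOb φ y :=
  nerve.homEquiv (e.map φ)

lemma nerveMor_comp {X : SSet.{max u v}} (φ : X ⟶ nerve D) {x y z : X _⦋0⦌}
    {e : X.Edge x y} {e' : X.Edge y z} {e'' : X.Edge x z} (h : SSet.Edge.CompStruct e e' e'') :
    nerveMor φ e ≫ nerveMor φ e' = nerveMor φ e'' :=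
  nerve.homEquiv_comp (h.map φ)

lemma app_edge {X : SSet.{max u v}} (φ : X ⟶ nerve D) {x y : X _⦋0⦌} (e : X.Edge x y) :
    φ.app _ e.edge = ComposableArrows.mk₁ (nerveMor φ e) :=
  ((nerve.mk₁_homEquiv_apply (e.map φ)).trans (ComposableArrows.mk₁_hom _)).symm

/-- Edges of a nerve carry their endpoints, so an equality of edges compares the morphisms only
after transport. -/
lemma eq_of_mk₁_eq {X Y X' Y' : D} {f : X ⟶ Y} {f' : X' ⟶ Y'}
    (h : ComposableArrows.mk₁ f = ComposableArrows.mk₁ f') :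
    ∃ (h₀ : X = X') (h₁ : Y = Y'), f = eqToHom h₀ ≫ f' ≫ eqToHom h₁.symm :=
  ⟨Functor.congr_obj h 0, Functor.congr_obj h 1,
    Functor.congr_hom h (homOfLE (Fin.zero_le (1 : Fin 2)))⟩

/-- The edge of a subcomplex of `Δ[k]` given by a `1`-simplex. -/
def subcomplexEdge {k : ℕ} {A : (Δ[k] : SSet.{w}).Subcomplex}
    (hA : ∀ x : (Δ[k] : SSet.{w}) _⦋0⦌, x ∈ A.obj (op ⦋0⦌))
    (x : (Δ[k] : SSet.{w}) _⦋1⦌) (hx : x ∈ A.obj (op ⦋1⦌)) :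
    SSet.Edge (X := (A : SSet.{w})) ⟨SSet.stdSimplex.obj₀Equiv.symm (x 0), hA _⟩
      ⟨SSet.stdSimplex.obj₀Equiv.symm (x 1), hA _⟩ :=
  SSet.Edge.mk ⟨x, hx⟩
    (Subtype.ext (SSet.stdSimplex.ext _ _ (fun i => by fin_cases i; rfl)))
    (Subtype.ext (SSet.stdSimplex.ext _ _ (fun i => by fin_cases i; rfl)))

lemma vertex_mem_boundary {k : ℕ} (x : (Δ[k + 1] : SSet.{w}) _⦋0⦌) :
    x ∈ (SSet.boundary (k + 1)).obj (op ⦋0⦌) := by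
  rw [SSet.boundary_obj_eq_univ 0 (k + 1)]
  exact Set.mem_univ _

/-- The nerve of a fully faithful functor which is surjective on objects has the right lifting
property with respect to the boundary inclusions. -/
lemma nerveMap_hasLiftingProperty_boundary {E : Type u} [Category.{v} E] (P : D ⥤ E) [P.Full]
    [P.Faithful] (hP : Function.Surjective P.obj) (k : ℕ) :
    HasLiftingProperty (SSet.boundary.{max u v} k).ι (nerveMap P) where
  sq_hasLift {φ ψ} sq := by
    obtain ⟨α, rfl⟩ := SSet.yonedaEquiv.symm.surjective ψ
    -- In dimension `0` the boundary is empty, and surjectivity on objects supplies the lift. In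
    -- higher dimensions the boundary contains all vertices, so the objects are prescribed by `φ`.
    obtain _ | k := k
    · obtain ⟨d, hd⟩ := hP (nerveEquiv α)
      refine ⟨⟨⟨SSet.yonedaEquiv.symm (ComposableArrows.mk₀ d : (nerve D) _⦋0⦌), ?_, ?_⟩⟩⟩
      · exact SSet.boundary.hom_ext₀
      · exact (SSet.yonedaEquiv_symm_comp _ _).trans (congrArg _ (ComposableArrows.ext₀ hd))
    · let α' : ComposableArrows E (k + 1) := α
      let v (j : Fin (k + 2)) : (SSet.boundary.{max u v} (k + 1) : SSet.{max u v}) _⦋0⦌ :=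
        ⟨SSet.stdSimplex.obj₀Equiv.symm j, vertex_mem_boundary _⟩
      have hob (j : Fin (k + 2)) : P.obj (nerveOb φ (v j)) = α'.obj j := by
        have h := ConcreteCategory.congr_hom (congr_app sq.w (op ⦋0⦌)) (v j)
        exact Functor.congr_obj h (0 : Fin 1)
      let F : ComposableArrows D (k + 1) :=
        { obj j := nerveOb φ (v j)
          -- Fullness lifts the morphisms of `α'`; faithfulness makes the lifts functorial and,
          -- below, equal to the edges already given by `φ`.
          map {a b} f := P.preimage (eqToHom (hob a) ≫ α'.map f ≫ eqToHom (hob b).symm)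
          map_id a := P.map_injective (by simp)
          map_comp f g := P.map_injective (by simp) }
      refine ⟨⟨⟨SSet.yonedaEquiv.symm (F : (nerve D) _⦋k + 1⦌), ?_, ?_⟩⟩⟩
      · apply nerve_extension
        intro x hx
        refine (app_edge φ (subcomplexEdge vertex_mem_boundary x hx)).trans (congrArg _ ?_)
        apply P.map_injective
        have h₁ := ConcreteCategory.congr_hom (congr_app sq.w (op ⦋1⦌)) ⟨x, hx⟩
        have h₂ := congrArg ((nerveMap P).app (op ⦋1⦌))
          (app_edge φ (subcomplexEdge vertex_mem_boundary x hx))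
        rw [nerveMap_app_mk₁] at h₂
        have h₃ : ((SSet.boundary.{max u v} (k + 1)).ι ≫ SSet.yonedaEquiv.symm α).app _ ⟨x, hx⟩ =
            ComposableArrows.mk₁
              (α'.map (homOfLE (SSet.stdSimplex.monotone_apply x (Fin.zero_le 1)))) :=
          ComposableArrows.ext₁ rfl rfl ((Category.id_comp _).trans (Category.comp_id _)).symm
        obtain ⟨e₀, e₁, h⟩ := eq_of_mk₁_eq (h₂.symm.trans (h₁.trans h₃))
        refine h.trans ?_
        exact (P.map_preimage _).symm
      · refine (SSet.yonedaEquiv_symm_comp _ _).trans (congrArg _ ?_)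
        exact CategoryTheory.Functor.ext hob (fun a b f => P.map_preimage _)

end NerveMor

/-! ### Unique horn fillers in nerves of groupoids -/

section Horn

variable {G : Type u} [Groupoid.{v} G]

/-- The two faces give `f` and `f ≫ g`, and `f` can be cancelled in a groupoid. -/
lemma nerve_two_simplex_ext_of_δ₂_δ₁ {s t : (nerve G) _⦋2⦌}
    (h₂ : (nerve G).δ (2 : Fin 3) s = (nerve G).δ (2 : Fin 3) t)
    (h₁ : (nerve G).δ (1 : Fin 3) s = (nerve G).δ (1 : Fin 3) t) : s = t := by
  obtain ⟨X₀, X₁, X₂, f, g, rfl⟩ := ComposableArrows.mk₂_surjective s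
  obtain ⟨X₀', X₁', X₂', f', g', rfl⟩ := ComposableArrows.mk₂_surjective t
  rw [nerve.δ₂_mk₂_eq, nerve.δ₂_mk₂_eq] at h₂
  rw [nerve.δ₁_mk₂_eq, nerve.δ₁_mk₂_eq] at h₁
  obtain ⟨rfl, rfl, e⟩ := eq_of_mk₁_eq h₂
  obtain ⟨_, rfl, e'⟩ := eq_of_mk₁_eq h₁
  simp only [eqToHom_refl, Category.comp_id, Category.id_comp] at e e'
  subst e
  rw [cancel_epi] at e'
  rw [e']

lemma nerve_two_simplex_ext_of_δ₁_δ₀ {s t : (nerve G) _⦋2⦌}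
    (h₁ : (nerve G).δ (1 : Fin 3) s = (nerve G).δ (1 : Fin 3) t)
    (h₀ : (nerve G).δ (0 : Fin 3) s = (nerve G).δ (0 : Fin 3) t) : s = t := by
  obtain ⟨X₀, X₁, X₂, f, g, rfl⟩ := ComposableArrows.mk₂_surjective s
  obtain ⟨X₀', X₁', X₂', f', g', rfl⟩ := ComposableArrows.mk₂_surjective t
  rw [nerve.δ₀_mk₂_eq, nerve.δ₀_mk₂_eq] at h₀
  rw [nerve.δ₁_mk₂_eq, nerve.δ₁_mk₂_eq] at h₁
  obtain ⟨rfl, rfl, e⟩ := eq_of_mk₁_eq h₀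
  obtain ⟨rfl, _, e'⟩ := eq_of_mk₁_eq h₁
  simp only [eqToHom_refl, Category.comp_id, Category.id_comp] at e e'
  subst e
  rw [cancel_mono] at e'
  rw [e']

/-- These faces form the spine, so nothing is cancelled and any category will do. -/
lemma nerve_two_simplex_ext_of_δ₂_δ₀ {D : Type u} [Category.{v} D] {s t : (nerve D) _⦋2⦌}
    (h₂ : (nerve D).δ (2 : Fin 3) s = (nerve D).δ (2 : Fin 3) t)
    (h₀ : (nerve D).δ (0 : Fin 3) s = (nerve D).δ (0 : Fin 3) t) : s = t := by
  obtain ⟨X₀, X₁, X₂, f, g, rfl⟩ := ComposableArrows.mk₂_surjective s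
  obtain ⟨X₀', X₁', X₂', f', g', rfl⟩ := ComposableArrows.mk₂_surjective t
  rw [nerve.δ₀_mk₂_eq, nerve.δ₀_mk₂_eq] at h₀
  rw [nerve.δ₂_mk₂_eq, nerve.δ₂_mk₂_eq] at h₂
  obtain ⟨rfl, rfl, e⟩ := eq_of_mk₁_eq h₀
  obtain ⟨rfl, _, e'⟩ := eq_of_mk₁_eq h₂
  simp only [eqToHom_refl, Category.comp_id, Category.id_comp] at e e'
  rw [e, e']

end Horn

section Horn

variable {G : Type u} [Groupoid.{v} G]

lemma vertex_mem_horn {n : ℕ} (i : Fin (n + 3)) (x : (Δ[n + 2] : SSet.{w}) _⦋0⦌) :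
    x ∈ (SSet.horn (n + 2) i).obj (op ⦋0⦌) := by
  rw [SSet.horn_obj_zero]
  exact Set.mem_univ _

lemma mem_horn_of_forall_ne {n d : ℕ} {i : Fin (n + 3)} (x : (Δ[n + 2] : SSet.{w}) _⦋d⦌)
    (k : Fin (n + 3)) (hk : k ≠ i) (h : ∀ j, x j ≠ k) : x ∈ (SSet.horn (n + 2) i).obj (op ⦋d⦌) :=
  (SSet.mem_horn_iff_notMem_range x i).2 ⟨k, hk, fun ⟨j, hj⟩ => h j hj⟩

/-- With at least three vertices, every edge through the central vertex `i` misses another vertex,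
hence lies in the horn. -/
lemma exists_ne_ne {n : ℕ} (i j : Fin (n + 3)) : ∃ k, k ≠ i ∧ k ≠ j := by
  obtain ⟨k, hk⟩ := Finset.exists_mem_notMem_of_card_lt_card
    (s := {i, j}) (t := (Finset.univ : Finset (Fin (n + 3))))
    (lt_of_le_of_lt Finset.card_le_two (by simp))
  simp only [Finset.mem_insert, Finset.mem_singleton, not_or] at hk
  exact ⟨k, hk.2.1, hk.2.2⟩

lemma edge_mem_horn {n : ℕ} {i a b : Fin (n + 3)} (hab : a ≤ b)
    (h : ∃ k, k ≠ i ∧ k ≠ a ∧ k ≠ b) :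
    SSet.stdSimplex.edge.{w} (n + 2) a b hab ∈ (SSet.horn (n + 2) i).obj (op ⦋1⦌) := by
  obtain ⟨k, hk, ha, hb⟩ := h
  refine mem_horn_of_forall_ne _ k hk (fun j => ?_)
  fin_cases j
  · exact ha.symm
  · exact hb.symm

lemma triangle_mem_horn {n : ℕ} {i a b c : Fin (n + 3)} (hab : a ≤ b) (hbc : b ≤ c)
    (h : ∃ k, k ≠ i ∧ k ≠ a ∧ k ≠ b ∧ k ≠ c) :
    SSet.stdSimplex.triangle.{w} a b c hab hbc ∈ (SSet.horn (n + 2) i).obj (op ⦋2⦌) := by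
  obtain ⟨k, hk, ha, hb, hc⟩ := h
  refine mem_horn_of_forall_ne _ k hk (fun j => ?_)
  fin_cases j
  · exact ha.symm
  · exact hb.symm
  · exact hc.symm

lemma edge_eta {n : ℕ} (x : (Δ[n] : SSet.{w}) _⦋1⦌) :
    SSet.stdSimplex.edge n (x 0) (x 1) (SSet.stdSimplex.monotone_apply x (Fin.zero_le 1)) = x := by
  ext j
  fin_cases j <;> rfl

/-- The vertices of the horn. -/
def hornVertex {n : ℕ} (i j : Fin (n + 3)) : (SSet.horn.{w} (n + 2) i : SSet.{w}) _⦋0⦌ :=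
  ⟨SSet.stdSimplex.obj₀Equiv.symm j, vertex_mem_horn i _⟩

/-- The edges of the horn. -/
def hornEdge {n : ℕ} {i : Fin (n + 3)} (a b : Fin (n + 3)) (hab : a ≤ b)
    (h : ∃ k, k ≠ i ∧ k ≠ a ∧ k ≠ b) :
    SSet.Edge (hornVertex.{w} i a) (hornVertex.{w} i b) :=
  subcomplexEdge (vertex_mem_horn i) _ (edge_mem_horn hab h)

/-- The triangles of the horn. -/
def hornCompStruct {n : ℕ} {i : Fin (n + 3)} {a b c : Fin (n + 3)} (hab : a ≤ b) (hbc : b ≤ c)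
    (h : ∃ k, k ≠ i ∧ k ≠ a ∧ k ≠ b ∧ k ≠ c) :
    SSet.Edge.CompStruct (hornEdge.{w} a b hab (i := i) (h.imp fun _ h => ⟨h.1, h.2.1, h.2.2.1⟩))
      (hornEdge.{w} b c hbc (i := i) (h.imp fun _ h => ⟨h.1, h.2.2.1, h.2.2.2⟩))
      (hornEdge.{w} a c (hab.trans hbc) (i := i) (h.imp fun _ h => ⟨h.1, h.2.1, h.2.2.2⟩)) :=
  SSet.Edge.CompStruct.mk ⟨SSet.stdSimplex.triangle a b c hab hbc, triangle_mem_horn hab hbc h⟩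
    (Subtype.ext (SSet.stdSimplex.ext _ _ (fun i => by fin_cases i <;> rfl)))
    (Subtype.ext (SSet.stdSimplex.ext _ _ (fun i => by fin_cases i <;> rfl)))
    (Subtype.ext (SSet.stdSimplex.ext _ _ (fun i => by fin_cases i <;> rfl)))

variable {n : ℕ} {i : Fin (n + 3)}

/-- The morphism from the object at the central vertex of the horn to the one at `j`. -/
noncomputable def hornRay (φ : (SSet.horn.{max u v} (n + 2) i : SSet.{max u v}) ⟶ nerve G)
    (j : Fin (n + 3)) : nerveOb φ (hornVertex i i) ⟶ nerveOb φ (hornVertex i j) :=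
  if h : i ≤ j then
    nerveMor φ (hornEdge i j h ((exists_ne_ne i j).imp fun _ h => ⟨h.1, h.1, h.2⟩))
  else
    Groupoid.inv (nerveMor φ (hornEdge j i (not_le.1 h).le
      ((exists_ne_ne i j).imp fun _ h => ⟨h.1, h.2, h.1⟩)))

/-- A vertex `k ≠ i` missed by the edge from `a` to `b` is also missed by the triangle on `i`, `a`,
`b`, so this triangle lies in the horn. The cases are the positions of `i` relative to `a ≤ b`. -/
lemma hornRay_comp (φ : (SSet.horn.{max u v} (n + 2) i : SSet.{max u v}) ⟶ nerve G)
    {a b : Fin (n + 3)} (hab : a ≤ b) (h : ∃ k, k ≠ i ∧ k ≠ a ∧ k ≠ b) :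
    hornRay φ a ≫ nerveMor φ (hornEdge a b hab h) = hornRay φ b := by
  unfold hornRay
  by_cases ha : i ≤ a
  · rw [dif_pos ha, dif_pos (ha.trans hab)]
    exact nerveMor_comp φ (hornCompStruct ha hab (h.imp fun _ h => ⟨h.1, h.1, h.2⟩))
  · rw [dif_neg ha]
    have ha' := (not_le.1 ha).le
    by_cases hb : i ≤ b
    · rw [dif_pos hb, ← nerveMor_comp φ
        (hornCompStruct ha' hb (h.imp fun _ h => ⟨h.1, h.2.1, h.1, h.2.2⟩))]
      simp
    · rw [dif_neg hb, ← nerveMor_comp φ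
        (hornCompStruct hab (not_le.1 hb).le (h.imp fun _ h => ⟨h.1, h.2.1, h.2.2, h.1⟩))]
      simp

/-- The filler of a horn in the nerve of a groupoid. -/
noncomputable def hornFiller (φ : (SSet.horn.{max u v} (n + 2) i : SSet.{max u v}) ⟶ nerve G) :
    ComposableArrows G (n + 2) where
  obj j := nerveOb φ (hornVertex i j)
  -- Travelling through the central vertex defines the map even for edges outside the horn;
  -- functoriality is cancellation.
  map {a b} _ := Groupoid.inv (hornRay φ a) ≫ hornRay φ b

lemma horn_ι_hornFiller (φ : (SSet.horn.{max u v} (n + 2) i : SSet.{max u v}) ⟶ nerve G) :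
    (SSet.horn (n + 2) i).ι ≫ SSet.yonedaEquiv.symm (hornFiller φ : (nerve G) _⦋n + 2⦌) = φ := by
  apply nerve_extension
  intro x hx
  have h : ∃ k, k ≠ i ∧ k ≠ x 0 ∧ k ≠ x 1 := by
    obtain ⟨k, hk, hk'⟩ := (SSet.mem_horn_iff_notMem_range x i).1 hx
    exact ⟨k, hk, fun h => hk' ⟨0, h.symm⟩, fun h => hk' ⟨1, h.symm⟩⟩
  have hab := SSet.stdSimplex.monotone_apply x (Fin.zero_le 1)
  have e : (hornEdge (x 0) (x 1) hab h).edge = ⟨x, hx⟩ := Subtype.ext (edge_eta x)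
  rw [← e, app_edge]
  refine congrArg _ ?_
  change _ = Groupoid.inv (hornRay φ _) ≫ hornRay φ _
  rw [← hornRay_comp φ hab h]
  simp

/-- Any edge is one side of a triangle with apex `i` whose other two sides lie in the horn, and two
faces determine a `2`-simplex in the nerve of a groupoid. -/
lemma horn_hom_ext {φ ψ : Δ[n + 2] ⟶ nerve G}
    (h : (SSet.horn (n + 2) i).ι ≫ φ = (SSet.horn (n + 2) i).ι ≫ ψ) : φ = ψ := by
  have key (a b : Fin (n + 3)) (hab : a ≤ b) (hi : ∃ k, k ≠ i ∧ k ≠ a ∧ k ≠ b) :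
      φ.app _ (SSet.stdSimplex.edge _ a b hab) = ψ.app _ (SSet.stdSimplex.edge _ a b hab) :=
    ConcreteCategory.congr_hom (congr_app h (op ⦋1⦌)) ⟨_, edge_mem_horn hab hi⟩
  have face (f : Δ[n + 2] ⟶ nerve G) (a b c : Fin (n + 3)) (hab : a ≤ b) (hbc : b ≤ c) :
      (nerve G).δ (2 : Fin 3) (f.app _ (SSet.stdSimplex.triangle a b c hab hbc)) =
          f.app _ (SSet.stdSimplex.edge _ a b hab) ∧
        (nerve G).δ (0 : Fin 3) (f.app _ (SSet.stdSimplex.triangle a b c hab hbc)) =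
          f.app _ (SSet.stdSimplex.edge _ b c hbc) ∧
        (nerve G).δ (1 : Fin 3) (f.app _ (SSet.stdSimplex.triangle a b c hab hbc)) =
          f.app _ (SSet.stdSimplex.edge _ a c (hab.trans hbc)) := by
    refine ⟨?_, ?_, ?_⟩
    all_goals
      refine (app_map f _ _).symm.trans (congrArg _ ?_)
      refine SSet.stdSimplex.ext _ _ (fun i => ?_)
      fin_cases i <;> rfl
  have hl (a : Fin (n + 3)) : ∃ k, k ≠ i ∧ k ≠ i ∧ k ≠ a :=
    (exists_ne_ne i a).imp fun _ h => ⟨h.1, h.1, h.2⟩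
  have hr (a : Fin (n + 3)) : ∃ k, k ≠ i ∧ k ≠ a ∧ k ≠ i :=
    (exists_ne_ne i a).imp fun _ h => ⟨h.1, h.2, h.1⟩
  suffices H : ∀ (a b : Fin (n + 3)) (hab : a ≤ b),
      φ.app _ (SSet.stdSimplex.edge _ a b hab) = ψ.app _ (SSet.stdSimplex.edge _ a b hab) by
    apply hom_ext_of_isStrictSegal
    intro x
    rw [← edge_eta x]
    exact H _ _ _
  intro a b hab
  by_cases ha : i ≤ a
  · obtain ⟨p₂, p₀, p₁⟩ := face φ i a b ha hab
    obtain ⟨q₂, q₀, q₁⟩ := face ψ i a b ha hab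
    rw [← p₀, ← q₀]
    refine congrArg _ (nerve_two_simplex_ext_of_δ₂_δ₁ ?_ ?_)
    · rw [p₂, q₂, key _ _ _ (hl a)]
    · rw [p₁, q₁, key _ _ _ (hl b)]
  · have ha' := (not_le.1 ha).le
    by_cases hb : i ≤ b
    · obtain ⟨p₂, p₀, p₁⟩ := face φ a i b ha' hb
      obtain ⟨q₂, q₀, q₁⟩ := face ψ a i b ha' hb
      rw [← p₁, ← q₁]
      refine congrArg _ (nerve_two_simplex_ext_of_δ₂_δ₀ ?_ ?_)
      · rw [p₂, q₂, key _ _ _ (hr a)]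
      · rw [p₀, q₀, key _ _ _ (hl b)]
    · have hb' := (not_le.1 hb).le
      obtain ⟨p₂, p₀, p₁⟩ := face φ a b i hab hb'
      obtain ⟨q₂, q₀, q₁⟩ := face ψ a b i hab hb'
      rw [← p₂, ← q₂]
      refine congrArg _ (nerve_two_simplex_ext_of_δ₁_δ₀ ?_ ?_)
      · rw [p₁, q₁, key _ _ _ (hr a)]
      · rw [p₀, q₀, key _ _ _ (hr b)]

/-- Horns of dimension at least two in the nerve of a groupoid have unique fillers. -/
lemma horn_precomp_bijective (G : Type u) [Groupoid.{v} G] (n : ℕ) (i : Fin (n + 3)) :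
    Function.Bijective (fun f : Δ[n + 2] ⟶ nerve G => (SSet.horn (n + 2) i).ι ≫ f) :=
  ⟨fun _ _ h => horn_hom_ext h, fun φ => ⟨_, horn_ι_hornFiller φ⟩⟩

end Horn

/-! ### Rows of the classifying diagram as nerves of categories -/

section IsoChains

variable (C : Type u) [Category.{v} C]

/-- The category of chains of `n` composable isomorphisms of `C`; the morphisms are all natural
transformations in `C`. -/
abbrev IsoChains (n : ℕ) : Type (max u v) :=
  InducedCategory (ComposableArrows C n)
    (fun F : ComposableArrows (Core C) n => F ⋙ Core.inclusion C)

variable {C}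

/-- The chain of isomorphisms underlying an object of `IsoChains C n`. -/
abbrev IsoChains.chain {n : ℕ} (F : IsoChains C n) : ComposableArrows (Core C) n := F

/-- The components of a morphism in `IsoChains C n`. -/
def IsoChains.app {n : ℕ} {F G : IsoChains C n} (f : F ⟶ G) (a : Fin (n + 1)) :
    (F.chain.obj a).of ⟶ (G.chain.obj a).of :=
  f.hom.app a

lemma IsoChains.naturality {n : ℕ} {F G : IsoChains C n} (f : F ⟶ G) {a b : Fin (n + 1)}
    (g : a ⟶ b) : (F.chain.map g).iso.hom ≫ IsoChains.app f b =
      IsoChains.app f a ≫ (G.chain.map g).iso.hom :=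
  f.hom.naturality g

/-- The simplex of a row of the classifying diagram given by a chain in `IsoChains C n`. -/
def ofIsoChains {m n : ℕ} (G : ComposableArrows (IsoChains C n) m) :
    ComposableArrows (Core (ComposableArrows C m)) n where
  obj a := ⟨{
    obj i := ((G.obj i).chain.obj a).of
    map f := IsoChains.app (G.map f) a
    map_id i := by rw [G.map_id]; rfl
    map_comp f g := by rw [G.map_comp]; rfl }⟩
  map {a b} f := ⟨{
    hom := {
      app i := ((G.obj i).chain.map f).iso.hom
      naturality i j g := (IsoChains.naturality (G.map g) f).symm }
    inv := {
      app i := ((G.obj i).chain.map f).iso.inv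
      naturality i j g := by
        rw [Iso.comp_inv_eq, Category.assoc, Iso.eq_inv_comp]
        exact IsoChains.naturality (G.map g) f }
    hom_inv_id := by ext i; exact Iso.hom_inv_id _
    inv_hom_id := by ext i; exact Iso.inv_hom_id _ }⟩
  map_id a := by
    apply Core.hom_ext
    ext i
    exact congrArg (fun e => (CoreHom.iso e).hom) ((G.obj i).chain.map_id a)
  map_comp f g := by
    apply Core.hom_ext
    ext i
    exact congrArg (fun e => (CoreHom.iso e).hom) ((G.obj i).chain.map_comp f g)

/-- The chain in `IsoChains C n` given by a simplex of a row of the classifying diagram. -/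
def toIsoChains {m n : ℕ} (F : ComposableArrows (Core (ComposableArrows C m)) n) :
    ComposableArrows (IsoChains C n) m where
  obj i := show ComposableArrows (Core C) n from {
    obj a := ⟨(F.obj a).of.obj i⟩
    map {a b} f := ⟨{
      hom := (F.map f).iso.hom.app i
      inv := (F.map f).iso.inv.app i
      hom_inv_id := congr_app (F.map f).iso.hom_inv_id i
      inv_hom_id := congr_app (F.map f).iso.inv_hom_id i }⟩
    map_id a := by
      apply Core.hom_ext
      exact congrArg (fun e => NatTrans.app (CoreHom.iso e).hom i) (F.map_id a)
    map_comp f g := by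
      apply Core.hom_ext
      exact congrArg (fun e => NatTrans.app (CoreHom.iso e).hom i) (F.map_comp f g) }
  map {i j} f := ⟨{
    app a := (F.obj a).of.map f
    naturality a b g := ((F.map g).iso.hom.naturality f).symm }⟩
  map_id i := by
    apply InducedCategory.hom_ext
    ext a
    exact (F.obj a).of.map_id i
  map_comp f g := by
    apply InducedCategory.hom_ext
    ext a
    exact (F.obj a).of.map_comp f g

/-- Chains of chains of isomorphisms are chains of isomorphisms of chains. -/
def isoChainsEquiv (m n : ℕ) :
    ComposableArrows (IsoChains C n) m ≃ ComposableArrows (Core (ComposableArrows C m)) n where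
  toFun := ofIsoChains
  invFun := toIsoChains
  left_inv _ := rfl
  right_inv _ := rfl

variable (C)

/-- The rows of the classifying diagram are nerves of categories. -/
def rowIso (n : SimplexCategoryᵒᵖ) :
    nerve (IsoChains C n.unop.len) ≅ (flipSpace (classifyingDiagram C)).obj n :=
  NatIso.ofComponents (fun m => (isoChainsEquiv m.unop.len n.unop.len).toIso) (fun _ => rfl)

variable {C}

/-- Restriction of chains of isomorphisms along a monotone map. -/
def isoChainsRestrict {m n : SimplexCategory} (θ : n ⟶ m) :
    IsoChains C m.len ⥤ IsoChains C n.len where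
  obj F := (SimplexCategory.toCat.map θ).toFunctor ⋙ F.chain
  map f := ⟨Functor.whiskerLeft (SimplexCategory.toCat.map θ).toFunctor f.hom⟩

lemma rowIso_naturality {m n : SimplexCategoryᵒᵖ} (θ : m ⟶ n) :
    nerveMap (isoChainsRestrict θ.unop) ≫ (rowIso C n).hom =
      (rowIso C m).hom ≫ (flipSpace (classifyingDiagram C)).map θ := rfl

/-- The isomorphism connecting two objects of a chain of isomorphisms. -/
def chainConn {G : Type u} [Groupoid.{v} G] {n : ℕ} (F : ComposableArrows G n)
    (a b : Fin (n + 1)) : F.obj a ⟶ F.obj b :=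
  -- The order gives only upward arrows; inverting them lets any vertex, not just the first, serve
  -- as base point.
  if h : a ≤ b then F.map (homOfLE h) else Groupoid.inv (F.map (homOfLE (not_le.1 h).le))

lemma chainConn_self {G : Type u} [Groupoid.{v} G] {n : ℕ} (F : ComposableArrows G n)
    (a : Fin (n + 1)) : chainConn F a a = 𝟙 _ :=
  (dif_pos le_rfl).trans (F.map_id a)

lemma chainConn_comp {G : Type u} [Groupoid.{v} G] {n : ℕ} (F : ComposableArrows G n)
    (a : Fin (n + 1)) {b c : Fin (n + 1)} (f : b ⟶ c) :
    chainConn F a b ≫ F.map f = chainConn F a c := by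
  have hbc := leOfHom f
  unfold chainConn
  by_cases hb : a ≤ b
  · rw [dif_pos hb, dif_pos (hb.trans hbc), ← F.map_comp]
    rfl
  · rw [dif_neg hb]
    by_cases hc : a ≤ c
    · rw [dif_pos hc, Groupoid.inv_eq_inv, IsIso.inv_comp_eq, ← F.map_comp]
      rfl
    · rw [dif_neg hc, Groupoid.inv_eq_inv, IsIso.inv_comp_eq, Groupoid.inv_eq_inv,
        IsIso.eq_comp_inv, ← F.map_comp]
      rfl

/-- The isomorphism in `C` connecting two objects of a chain of isomorphisms. -/
def IsoChains.conn {n : ℕ} (F : IsoChains C n) (a b : Fin (n + 1)) :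
    (F.chain.obj a).of ≅ (F.chain.obj b).of :=
  (chainConn F.chain a b).iso

/-- The components of `f` need not be invertible, but the chain maps are, so naturality squares can
be reversed. -/
lemma IsoChains.conn_naturality {n : ℕ} {F G : IsoChains C n} (f : F ⟶ G) (a b : Fin (n + 1)) :
    (F.conn a b).hom ≫ IsoChains.app f b = IsoChains.app f a ≫ (G.conn a b).hom := by
  unfold IsoChains.conn chainConn
  by_cases h : a ≤ b
  · rw [dif_pos h, dif_pos h]
    exact IsoChains.naturality f (homOfLE h)
  · rw [dif_neg h, dif_neg h]
    change Iso.inv _ ≫ _ = _ ≫ Iso.inv _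
    rw [Iso.inv_comp_eq, ← Category.assoc, Iso.eq_comp_inv]
    exact (IsoChains.naturality f (homOfLE (not_le.1 h).le)).symm

lemma IsoChains.conn_self {n : ℕ} (F : IsoChains C n) (a : Fin (n + 1)) :
    F.conn a a = Iso.refl _ :=
  congrArg CoreHom.iso (chainConn_self F.chain a)

lemma IsoChains.conn_comp {n : ℕ} (F : IsoChains C n) (a : Fin (n + 1)) {b c : Fin (n + 1)}
    (f : b ⟶ c) : (F.conn a b).hom ≫ (F.chain.map f).iso.hom = (F.conn a c).hom :=
  congrArg (fun e => (CoreHom.iso e).hom) (chainConn_comp F.chain a f)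

section

variable {n : ℕ} (θ : ⦋0⦌ ⟶ ⦋n⦌)

/-- The component at the base vertex `θ 0` determines all others through the connecting
isomorphisms. -/
instance : (isoChainsRestrict (C := C) θ).Faithful where
  map_injective {F G f g} h := by
    have h₀ : IsoChains.app f (θ 0) = IsoChains.app g (θ 0) :=
      congrArg (fun e => NatTrans.app (InducedCategory.Hom.hom e) (0 : Fin 1)) h
    apply InducedCategory.hom_ext
    apply NatTrans.ext
    funext b
    have e : (F.conn (θ 0) b).hom ≫ IsoChains.app f b =
        (F.conn (θ 0) b).hom ≫ IsoChains.app g b := by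
      rw [IsoChains.conn_naturality, IsoChains.conn_naturality, h₀]
    exact (Iso.cancel_iso_hom_left (F.conn (θ 0) b) _ _).1 e

/-- A single component at `θ 0` extends to all vertices by conjugation with the connecting
isomorphisms. -/
instance : (isoChainsRestrict (C := C) θ).Full where
  map_surjective {F G} f := by
    let f₀ : (F.chain.obj (θ 0)).of ⟶ (G.chain.obj (θ 0)).of := f.hom.app (0 : Fin 1)
    have hnat {b c : Fin (n + 1)} (g : b ⟶ c) : (F.chain.map g).iso.hom ≫
        (F.conn (θ 0) c).inv ≫ f₀ ≫ (G.conn (θ 0) c).hom =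
        ((F.conn (θ 0) b).inv ≫ f₀ ≫ (G.conn (θ 0) b).hom) ≫ (G.chain.map g).iso.hom := by
      rw [← cancel_epi (F.conn (θ 0) b).hom, ← Category.assoc, F.conn_comp]
      simp only [Category.assoc, Iso.hom_inv_id_assoc, G.conn_comp]
    refine ⟨⟨{
      app b := (F.conn (θ 0) b).inv ≫ f₀ ≫ (G.conn (θ 0) b).hom
      naturality b c g := hnat g }⟩, ?_⟩
    apply InducedCategory.hom_ext
    apply ComposableArrows.hom_ext₀
    change (F.conn (θ 0) (θ 0)).inv ≫ f₀ ≫ (G.conn (θ 0) (θ 0)).hom = f₀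
    rw [IsoChains.conn_self, IsoChains.conn_self]
    exact (Category.id_comp _).trans (Category.comp_id _)

/-- Constant chains are preimages. -/
lemma isoChainsRestrict_obj_surjective :
    Function.Surjective (isoChainsRestrict (C := C) θ).obj := fun F =>
  ⟨(Functor.const (Fin (n + 1))).obj (F.chain.obj (0 : Fin 1)),
    ComposableArrows.ext₀ (C := Core C) rfl⟩

end

end IsoChains

/-! ### From unique extension in columns to mapping spaces -/

section Columns

variable {W : SimplicialSpace.{w}}

/-- The map to a column of `W` given by a map to a space of row maps and a simplex of the source
of the row maps. -/
def column {A K : SSet.{w}} (φ : A ⟶ rowMaps W K) {m : SimplexCategoryᵒᵖ} (x : K.obj m) :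
    A ⟶ W.obj m where
  app p := ↾fun y => NatTrans.app (show K ⟶ (flipSpace W).obj p from φ.app p y) m x
  naturality p q θ := by
    ext y
    have h : φ.app q (A.map θ y) = _ := app_map φ θ y
    exact congrArg (fun g => NatTrans.app (show K ⟶ (flipSpace W).obj q from g) m x) h

lemma column_map {A K : SSet.{w}} (φ : A ⟶ rowMaps W K) {m n : SimplexCategoryᵒᵖ} (θ : m ⟶ n)
    (x : K.obj m) : column φ (K.map θ x) = column φ x ≫ W.map θ := by
  apply SSet.hom_ext
  intro p
  ext y
  exact app_map (show K ⟶ (flipSpace W).obj p from φ.app p y) θ x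

lemma ext_of_column {A K : SSet.{w}} {φ ψ : A ⟶ rowMaps W K}
    (h : ∀ (m : SimplexCategoryᵒᵖ) (x : K.obj m), column φ x = column ψ x) : φ = ψ := by
  apply SSet.hom_ext
  intro p
  ext y
  apply SSet.hom_ext
  intro m
  ext x
  exact ConcreteCategory.congr_hom (congr_app (h m x) p) y

/-- If each space of `W` has unique extensions along `A ⊆ Δ[n]`, so has each space of row maps. -/
lemma rowMaps_precomp_bijective {n : ℕ} (A : (Δ[n] : SSet.{w}).Subcomplex)
    (hW : ∀ m, Function.Bijective (fun f : Δ[n] ⟶ W.obj m => A.ι ≫ f)) (K : SSet.{w}) :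
    Function.Bijective (fun f : Δ[n] ⟶ rowMaps W K => A.ι ≫ f) := by
  constructor
  · intro f g h
    apply ext_of_column
    intro m x
    apply (hW m).injective
    exact congrArg (fun φ => column φ x) h
  · intro φ
    choose s hs using fun (m : SimplexCategoryᵒᵖ) (x : K.obj m) => (hW m).surjective (column φ x)
    let g : K ⟶ (flipSpace W).obj (op ⦋n⦌) :=
      { app m := ↾fun x => SSet.yonedaEquiv (X := W.obj m) (n := ⦋n⦌) (s m x)
        naturality m m' θ := by
          ext x
          -- The extensions are chosen independently for each `x`; uniqueness makes them compatible
          -- with the simplicial operators.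
          have h : s m' (K.map θ x) = s m x ≫ W.map θ := by
            apply (hW m').injective
            refine (hs _ _).trans ((column_map φ θ x).trans ?_)
            exact congrArg (· ≫ W.map θ) (hs m x).symm
          exact congrArg (SSet.yonedaEquiv (X := W.obj m') (n := ⦋n⦌)) h }
    refine ⟨SSet.yonedaEquiv.symm (g : (rowMaps W K).obj (op ⦋n⦌)), ext_of_column (fun m x => ?_)⟩
    refine Eq.trans ?_ (hs m x)
    apply SSet.hom_ext
    intro p
    ext y
    exact ConcreteCategory.congr_hom
      (congr_app (SSet.yonedaEquiv.symm_apply_apply (s m x)) p) y.1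

/-- Unique extension along `A ⊆ Δ[n]` for the spaces of `W` gives lifts for restriction maps. -/
lemma rowMapsPrecomp_hasLiftingProperty {n : ℕ} (A : (Δ[n] : SSet.{w}).Subcomplex)
    (hW : ∀ m, Function.Bijective (fun f : Δ[n] ⟶ W.obj m => A.ι ≫ f)) {K L : SSet.{w}}
    (i : K ⟶ L) : HasLiftingProperty A.ι (rowMapsPrecomp W i) where
  sq_hasLift {φ ψ} sq := by
    obtain ⟨l, hl⟩ := (rowMaps_precomp_bijective A hW L).surjective φ
    -- The second triangle comes from uniqueness: both of its sides extend the same map on `A`.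
    refine ⟨⟨⟨l, hl, (rowMaps_precomp_bijective A hW K).injective ?_⟩⟩⟩
    dsimp only at hl ⊢
    rw [← Category.assoc, hl, sq.w]

end Columns

/-! ### One-dimensional horns and transposed lifting problems -/

section OneHorn

/-- The vertex of a one-dimensional horn. -/
def oneHornVertex (i : Fin 2) : (SSet.horn.{w} 1 i : SSet.{w}) _⦋0⦌ :=
  ⟨SSet.stdSimplex.obj₀Equiv.symm i, (SSet.mem_horn_iff_notMem_range _ i).2
    ⟨i.rev, by fin_cases i <;> decide, fun ⟨_, hj⟩ => (by fin_cases i <;> decide : i ≠ i.rev) hj⟩⟩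

/-- The horn is the single vertex `i`: all its simplices are constant at `i`. -/
lemma oneHorn_hom_ext {i : Fin 2} {Y : SSet.{w}} {f g : (SSet.horn.{w} 1 i : SSet.{w}) ⟶ Y}
    (h : f.app _ (oneHornVertex i) = g.app _ (oneHornVertex i)) : f = g := by
  apply SSet.hom_ext
  rintro ⟨⟨m⟩⟩
  ext ⟨x, hx⟩
  obtain ⟨j, hj, hj'⟩ := (SSet.mem_horn_iff_notMem_range x i).1 hx
  have e : (⟨x, hx⟩ : (SSet.horn.{w} 1 i : SSet.{w}) _⦋m⦌) =
      (SSet.horn.{w} 1 i : SSet.{w}).map (SimplexCategory.const ⦋m⦌ ⦋0⦌ 0).op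
        (oneHornVertex i) := by
    refine Subtype.ext (SSet.stdSimplex.ext _ _ (fun l => ?_))
    change x l = i
    have h₁ : x l ≠ j := fun h => hj' ⟨l, h⟩
    omega
  rw [e]
  exact (app_map f _ _).trans ((congrArg (Y.map _) h).trans (app_map g _ _).symm)

/-- The map `[0] ⟶ [1]` with value `i`. -/
abbrev vertexMap (i : Fin 2) : ⦋0⦌ ⟶ ⦋1⦌ := SimplexCategory.const ⦋0⦌ ⦋1⦌ i

/-- Lifting against one-dimensional horns for restrictions of row maps. -/
lemma rowMapsPrecomp_hasLiftingProperty_oneHorn {W : SimplicialSpace.{w}} {K L : SSet.{w}}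
    (j : K ⟶ L) (i : Fin 2)
    (hW : HasLiftingProperty j ((flipSpace W).map (vertexMap i).op)) :
    HasLiftingProperty (SSet.horn.{w} 1 i).ι (rowMapsPrecomp W j) where
  sq_hasLift {φ ψ} sq := by
    let a : L ⟶ (flipSpace W).obj (op ⦋0⦌) := φ.app _ (oneHornVertex i)
    obtain ⟨b', rfl⟩ := SSet.yonedaEquiv.symm.surjective ψ
    let b : K ⟶ (flipSpace W).obj (op ⦋1⦌) := b'
    -- Transposed problem: the horn gives `a` on `L` in row `0`, the edge gives `b` on `K` in row
    -- `1`, and a diagonal is a map from `L` to row `1`.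
    have sq' : CommSq b j ((flipSpace W).map (vertexMap i).op) a :=
      ⟨(ConcreteCategory.congr_hom (congr_app sq.w (op ⦋0⦌)) (oneHornVertex i)).symm⟩
    refine ⟨⟨⟨SSet.yonedaEquiv.symm (sq'.lift : (rowMaps W L).obj (op ⦋1⦌)), ?_, ?_⟩⟩⟩
    · exact oneHorn_hom_ext sq'.fac_right
    · exact (SSet.yonedaEquiv_symm_comp _ _).trans (congrArg _ sq'.fac_left)

end OneHorn

/-! ### Reedy fibrancy and the Segal condition -/

section Segal

/-- Isomorphisms are weak equivalences. -/
lemma isWeakEquivalence_of_isIso {X Y : SSet.{w}} (f : X ⟶ Y) [IsIso f] : IsWeakEquivalence f := by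
  intro K _
  refine Function.bijective_iff_has_inverse.2 ⟨HomotopyClasses.precomp (inv f) K, ?_, ?_⟩
  · rintro ⟨g⟩
    exact congrArg (Quot.mk _) (IsIso.inv_hom_id_assoc f g)
  · rintro ⟨g⟩
    exact congrArg (Quot.mk _) (IsIso.hom_inv_id_assoc f g)

lemma precomp_bijective_of_iso {E : Type u} [Category.{v} E] {A B Y Z : E} (i : A ⟶ B)
    (e : Y ≅ Z) (h : Function.Bijective (fun f : B ⟶ Y => i ≫ f)) :
    Function.Bijective (fun f : B ⟶ Z => i ≫ f) := by
  constructor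
  · intro f g hfg
    have := h.injective (a₁ := f ≫ e.inv) (a₂ := g ≫ e.inv) (by simpa using congrArg (· ≫ e.inv) hfg)
    exact (cancel_mono _).1 this
  · intro f
    obtain ⟨g, hg⟩ := h.surjective (f ≫ e.inv)
    exact ⟨g ≫ e.hom, by simpa using congrArg (· ≫ e.hom) hg⟩

variable (C : Type u) [Category.{v} C]

lemma isReedyFibrant_classifyingDiagram : IsReedyFibrant (classifyingDiagram C) := by
  intro k
  refine (MorphismProperty.arrow_mk_iso_iff SSet.modelCategoryQuillen.J.rlp
    (rowMapsArrowIso (classifyingDiagram C) (SSet.boundary k).ι)).2 ?_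
  intro A B f hf
  simp only [SSet.modelCategoryQuillen.J, MorphismProperty.iSup_iff] at hf
  obtain ⟨n, ⟨i⟩⟩ := hf
  -- The index is one less than the dimension of the horn, so the first case treats the
  -- one-dimensional horns.
  obtain _ | n := n
  · apply rowMapsPrecomp_hasLiftingProperty_oneHorn
    have h : Arrow.mk (nerveMap (isoChainsRestrict (C := C) (vertexMap i))) ≅
        Arrow.mk ((flipSpace (classifyingDiagram C)).map (vertexMap i).op) :=
      Arrow.isoMk (rowIso C (op ⦋1⦌)) (rowIso C (op ⦋0⦌))
        (rowIso_naturality (vertexMap i).op).symm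
    have := nerveMap_hasLiftingProperty_boundary (isoChainsRestrict (C := C) (vertexMap i))
      (isoChainsRestrict_obj_surjective _) k
    exact HasLiftingProperty.of_arrow_iso_right _ h
  · exact rowMapsPrecomp_hasLiftingProperty _
      (fun m => horn_precomp_bijective (Core (ComposableArrows C m.unop.len)) n i) _

/-- Every row is a nerve, so the Segal maps are bijective in each degree. -/
lemma isSegalSpace_classifyingDiagram : IsSegalSpace (classifyingDiagram C) where
  reedyFibrant := isReedyFibrant_classifyingDiagram C
  segal k := by
    have h : IsIso (rowMapsPrecomp (classifyingDiagram C) (spine k).ι) := by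
      rw [NatTrans.isIso_iff_isIso_app]
      intro n
      rw [isIso_iff_bijective]
      exact precomp_bijective_of_iso (spine k).ι (rowIso C n)
        (spine_precomp_bijective k (nerve (IsoChains C n.unop.len)))
    have : IsIso (mapSpacePrecomp (spineInclusion k) (classifyingDiagram C)) :=
      (MorphismProperty.arrow_mk_iso_iff (MorphismProperty.isomorphisms _)
        (rowMapsArrowIso (classifyingDiagram C) (spine k).ι)).2 h
    exact isWeakEquivalence_of_isIso _

end Segal

/-! ### Weak equivalences from deformation retractions -/

section Homotopy

/-- Homotopies can be postcomposed. -/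
lemma SimpliciallyHomotopic.postcomp {X K L : SSet.{w}} {f g : X ⟶ K}
    (H : SimpliciallyHomotopic f g) (k : K ⟶ L) : SimpliciallyHomotopic (f ≫ k) (g ≫ k) := by
  obtain ⟨H, rfl, rfl⟩ := H
  exact ⟨H ≫ k, (Category.assoc _ _ _).symm, (Category.assoc _ _ _).symm⟩

/-- Simplicial deformation retractions are weak equivalences. -/
lemma isWeakEquivalence_of_deformation {X Y : SSet.{w}} (f : X ⟶ Y) (g : Y ⟶ X)
    (hfg : f ≫ g = 𝟙 X) (hgf : SimpliciallyHomotopic (g ≫ f) (𝟙 Y)) : IsWeakEquivalence f := by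
  intro K _
  refine Function.bijective_iff_has_inverse.2 ⟨HomotopyClasses.precomp g K, ?_, ?_⟩
  · rintro ⟨k⟩
    have h := Quot.sound (r := SimpliciallyHomotopic) (hgf.postcomp k)
    rw [Category.assoc, Category.id_comp] at h
    exact h
  · rintro ⟨k⟩
    have h : f ≫ g ≫ k = k := by rw [← Category.assoc, hfg, Category.id_comp]
    exact congrArg (Quot.mk _) h

variable {D E : Type u} [Category.{v} D] [Category.{v} E]

/-- The functor on a chain with values in `F` or `G`, as prescribed by a simplex of `Δ[1]`. -/
def natTransChain {F G : D ⥤ E} (τ : F ⟶ G) {m : SimplexCategoryᵒᵖ}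
    (x : ComposableArrows D m.unop.len) (ε : (Δ[1] : SSet.{w}).obj m) :
    ComposableArrows E m.unop.len :=
  Functor.prod' (SimplexCategory.toCat.map (SSet.stdSimplex.objEquiv ε)).toFunctor x ⋙
    Functor.uncurry.obj (ComposableArrows.mk₁ τ)

/-- A natural transformation induces a homotopy between maps of nerves. -/
lemma simpliciallyHomotopic_nerveMap {F G : D ⥤ E} (τ : F ⟶ G) :
    SimpliciallyHomotopic (nerveMap F) (nerveMap G) := by
  refine ⟨{
    app m := ↾fun (x : ComposableArrows D m.unop.len × (Δ[1] : SSet.{max u v}).obj m) =>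
      natTransChain τ x.1 x.2
    naturality m n θ := rfl }, ?_, ?_⟩
  · apply SSet.hom_ext
    intro m
    ext (x : ComposableArrows D m.unop.len)
    refine CategoryTheory.Functor.ext (fun i => rfl) (fun i j f => ?_)
    change 𝟙 _ ≫ F.map (x.map f) = 𝟙 _ ≫ F.map (x.map f) ≫ 𝟙 _
    rw [Category.comp_id]
  · apply SSet.hom_ext
    intro m
    ext (x : ComposableArrows D m.unop.len)
    refine CategoryTheory.Functor.ext (fun i => rfl) (fun i j f => ?_)
    change 𝟙 _ ≫ G.map (x.map f) = 𝟙 _ ≫ G.map (x.map f) ≫ 𝟙 _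
    rw [Category.comp_id]

end Homotopy

/-! ### Homotopy equivalences are isomorphisms -/

section HoEquiv

variable {C : Type u} [Category.{v} C]

/-- The arrow of `C` given by a point of the first space of the classifying diagram. -/
abbrev pointArrow (g : ComposableArrows (Core (ComposableArrows C 1)) 0) :
    (g.obj (0 : Fin 1)).of.left ⟶ (g.obj (0 : Fin 1)).of.right :=
  (g.obj (0 : Fin 1)).of.hom

lemma point_ext {D : Type u} [Category.{v} D] {p q : ComposableArrows (Core D) 0}
    (h : (p.obj (0 : Fin 1)).of = (q.obj (0 : Fin 1)).of) : p = q :=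
  ComposableArrows.ext₀ (congrArg Core.mk h)

lemma mem_hom {W : SimplicialSpace.{w}} {x y : Ob W} {g : (W _⦋1⦌ : SSet.{w}) _⦋0⦌}
    (h₁ : (W.δ (1 : Fin 2)).app _ g = x) (h₀ : (W.δ (0 : Fin 2)).app _ g = y) :
    g ∈ (hom W x y).obj (op ⦋0⦌) := by
  subst h₁ h₀
  exact ⟨SSet.Subcomplex.mem_ofSimplex_obj _, SSet.Subcomplex.mem_ofSimplex_obj _⟩

lemma isIso_hom_iff_of_iso {F G : ComposableArrows C 1} (e : F ≅ G) :
    IsIso F.hom ↔ IsIso G.hom := by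
  have h : F.hom ≫ e.hom.app 1 = e.hom.app 0 ≫ G.hom := e.hom.naturality _
  constructor
  · intro _
    have : IsIso (e.hom.app 0 ≫ G.hom) := by rw [← h]; infer_instance
    exact IsIso.of_isIso_comp_left (e.hom.app 0) G.hom
  · intro _
    have : IsIso (F.hom ≫ e.hom.app 1) := by rw [h]; infer_instance
    exact IsIso.of_isIso_comp_right F.hom (e.hom.app 1)

/-- Whether a point of the first space of the classifying diagram is an isomorphism depends only
on its component. -/
lemma isIso_pointArrow_iff {g g' : (nerve (Core (ComposableArrows C 1))) _⦋0⦌}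
    (h : SSet.π₀.mk g = SSet.π₀.mk g') : IsIso (pointArrow g) ↔ IsIso (pointArrow g') := by
  -- An edge of this nerve is an isomorphism of arrows, so invertibility descends to a function on
  -- `π₀`.
  have := congrArg (SSet.π₀.lift
    (fun (p : (nerve (Core (ComposableArrows C 1))) _⦋0⦌) => IsIso (pointArrow p))
    (fun p q e => by
      have e' := CoreHom.iso (nerve.homEquiv e)
      exact propext (isIso_hom_iff_of_iso e'))) h
  simpa using this

/-- Being in one component of the mapping space implies being in one component of `W_1`, where
`idHom` is an identity arrow. -/
lemma isIso_pointArrow_of_homotopic_idHom {x : Ob (classifyingDiagram C)}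
    {g : Hom (classifyingDiagram C) x x} (h : Homotopic g (idHom _ x)) :
    IsIso (pointArrow g.1) := by
  refine (isIso_pointArrow_iff (congrArg (SSet.mapπ₀ (hom (classifyingDiagram C) x x).ι) h)).2 ?_
  have e : pointArrow (idHom (classifyingDiagram C) x).1 = 𝟙 _ :=
    CategoryTheory.Functor.map_id (Functor.obj (C := Fin 1) x (0 : Fin 1)).of (0 : Fin 1)
  change IsIso (pointArrow (idHom (classifyingDiagram C) x).1)
  rw [e]
  exact IsIso.id _

lemma isSplitEpi_of_isIso_comp {X Y Z : C} (f : X ⟶ Y) (g : Y ⟶ Z) [IsIso (f ≫ g)] :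
    IsSplitEpi g :=
  ⟨⟨inv (f ≫ g) ≫ f, by rw [Category.assoc, IsIso.inv_hom_id]⟩⟩

lemma isSplitMono_of_isIso_comp {X Y Z : C} (f : X ⟶ Y) (g : Y ⟶ Z) [IsIso (f ≫ g)] :
    IsSplitMono f :=
  ⟨⟨g ≫ inv (f ≫ g), by rw [← Category.assoc, IsIso.hom_inv_id]⟩⟩

/-- Composites homotopic to identities are isomorphisms, so `g` is split epi and split mono.
Conversely, a strict inverse is a homotopy inverse. -/
lemma isHoEquivPoint_iff (g : (nerve (Core (ComposableArrows C 1))) _⦋0⦌) :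
    IsHoEquivPoint (classifyingDiagram C) g ↔ IsIso (pointArrow g) := by
  constructor
  · rintro ⟨x, y, hg, ⟨f, gf, ⟨k, -, hk₀, hk₁⟩, hgf⟩, ⟨h, hg', ⟨l, hl₂, -, hl₁⟩, hhg⟩⟩
    replace hgf := isIso_pointArrow_of_homotopic_idHom hgf
    replace hhg := isIso_pointArrow_of_homotopic_idHom hhg
    rw [← hk₁] at hgf
    rw [← hl₁] at hhg
    let K : ComposableArrows C 2 := (Functor.obj (C := Fin 1) k (0 : Fin 1)).of
    let L : ComposableArrows C 2 := (Functor.obj (C := Fin 1) l (0 : Fin 1)).of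
    let e₀ : (0 : Fin 3) ⟶ 1 := homOfLE (Fin.zero_le _)
    let e₁ : (1 : Fin 3) ⟶ 2 := homOfLE (Fin.le_last _)
    have hK : IsIso (K.map e₀ ≫ K.map e₁) := by rw [← K.map_comp]; exact hgf
    have hL : IsIso (L.map e₀ ≫ L.map e₁) := by rw [← L.map_comp]; exact hhg
    have h₁ : IsSplitEpi (pointArrow g) :=
      Eq.subst (motive := fun p => IsSplitEpi (pointArrow p)) hk₀
        (isSplitEpi_of_isIso_comp (K.map e₀) (K.map e₁))
    have h₂ : IsSplitMono (pointArrow g) :=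
      Eq.subst (motive := fun p => IsSplitMono (pointArrow p)) hl₂
        (isSplitMono_of_isIso_comp (L.map e₀) (L.map e₁))
    exact isIso_of_mono_of_isSplitEpi _
  · intro hg
    let W := classifyingDiagram C
    -- The chains `g⁻¹, g` and `g, g⁻¹` have identities as middle faces, so the required homotopies
    -- are reflexive.
    let k : (W _⦋2⦌ : SSet) _⦋0⦌ := (ComposableArrows.mk₀
      (Core.mk (ComposableArrows.mk₂ (inv (pointArrow g)) (pointArrow g))) :
        ComposableArrows (Core (ComposableArrows C 2)) 0)
    let l : (W _⦋2⦌ : SSet) _⦋0⦌ := (ComposableArrows.mk₀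
      (Core.mk (ComposableArrows.mk₂ (pointArrow g) (inv (pointArrow g)))) :
        ComposableArrows (Core (ComposableArrows C 2)) 0)
    let x : Ob W := (W.δ (1 : Fin 2)).app _ g
    let y : Ob W := (W.δ (0 : Fin 2)).app _ g
    have hk₀ : (W.δ (0 : Fin 3)).app _ k = g := point_ext (ComposableArrows.ext₁ rfl rfl
      ((Category.id_comp _).trans (Category.comp_id _)).symm)
    have hl₂ : (W.δ (2 : Fin 3)).app _ l = g := point_ext (ComposableArrows.ext₁ rfl rfl
      ((Category.id_comp _).trans (Category.comp_id _)).symm)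
    have hk₁ : (W.δ (1 : Fin 3)).app _ k = (idHom W y).1 :=
      point_ext (ComposableArrows.ext₁ rfl rfl (by
        refine Eq.trans ?_ ((Category.id_comp _).trans (Category.comp_id _)).symm
        exact (IsIso.inv_hom_id (pointArrow g)).trans
          ((g.obj (0 : Fin 1)).of.map_id (1 : Fin 2)).symm))
    have hl₁ : (W.δ (1 : Fin 3)).app _ l = (idHom W x).1 :=
      point_ext (ComposableArrows.ext₁ rfl rfl (by
        refine Eq.trans ?_ ((Category.id_comp _).trans (Category.comp_id _)).symm
        exact (IsIso.hom_inv_id (pointArrow g)).trans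
          ((g.obj (0 : Fin 1)).of.map_id (0 : Fin 2)).symm))
    refine ⟨x, y, mem_hom rfl rfl,
      ⟨⟨(W.δ (2 : Fin 3)).app _ k, mem_hom (point_ext (ComposableArrows.ext₀ rfl))
        (point_ext (ComposableArrows.ext₀ rfl))⟩, idHom W y, ⟨k, rfl, hk₀, hk₁⟩, rfl⟩,
      ⟨⟨(W.δ (0 : Fin 3)).app _ l, mem_hom (point_ext (ComposableArrows.ext₀ rfl))
        (point_ext (ComposableArrows.ext₀ rfl))⟩, idHom W x, ⟨l, hl₂, rfl, hl₁⟩, rfl⟩⟩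

/-- Since invertibility is constant on components, testing the vertices of `s` tests every point of
their components. -/
lemma mem_hoequiv_iff {n : SimplexCategoryᵒᵖ}
    (s : (nerve (Core (ComposableArrows C 1))).obj n) :
    s ∈ (hoequiv (classifyingDiagram C)).obj n ↔
      ∀ a : Fin (n.unop.len + 1), IsIso (Functor.obj (C := Fin (n.unop.len + 1)) s a).of.hom := by
  constructor
  · intro hs a
    exact (isHoEquivPoint_iff _).1 (hs (SimplexCategory.const ⦋0⦌ n.unop a).op _ rfl)
  · intro hs i g hg
    exact (isHoEquivPoint_iff g).2 ((isIso_pointArrow_iff hg).2 (hs (i.unop 0)))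

end HoEquiv

/-! ### Completeness -/

section Completeness

variable (C : Type u) [Category.{v} C]

/-- The isomorphisms, as objects of the groupoid of arrows of `C`. -/
def isoProperty : ObjectProperty (Core (ComposableArrows C 1)) := fun F => IsIso F.of.hom

/-- The groupoid of isomorphisms of `C`. -/
abbrev IsoArrow : Type (max u v) := (isoProperty C).FullSubcategory

/-- The space of homotopy equivalences of the classifying diagram is the nerve of the groupoid of
isomorphisms. -/
def hoequivIso : (hoequiv (classifyingDiagram C) : SSet.{max u v}) ≅ nerve (IsoArrow C) where
  hom :=
    { app n := ↾fun s => (isoProperty C).lift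
        (show ComposableArrows (Core (ComposableArrows C 1)) n.unop.len from s.1)
        ((mem_hoequiv_iff s.1).1 s.2)
      naturality _ _ _ := rfl }
  inv := SSet.Subcomplex.lift (nerveMap (isoProperty C).ι) (by
    rintro n _ ⟨x, rfl⟩
    exact (mem_hoequiv_iff _).2
      (fun a => (Functor.obj (C := Fin (n.unop.len + 1)) x a).property))

/-- The degeneracy functor from objects to isomorphisms. -/
def degenerateIso : Core (ComposableArrows C 0) ⥤ IsoArrow C :=
  (isoProperty C).lift (isoRestrict C (SimplexCategory.σ (0 : Fin 1))) (fun F => by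
    have e : ((isoRestrict C (SimplexCategory.σ (0 : Fin 1))).obj F).of.hom = 𝟙 (F.of.obj 0) :=
      F.of.map_id 0
    change IsIso ((isoRestrict C (SimplexCategory.σ (0 : Fin 1))).obj F).of.hom
    rw [e]
    exact IsIso.id _)

/-- The source functor from isomorphisms to objects. -/
def sourceOfIso : IsoArrow C ⥤ Core (ComposableArrows C 0) :=
  (isoProperty C).ι ⋙ isoRestrict C (SimplexCategory.δ (1 : Fin 2))

variable {C} in
/-- The isomorphism from the identity of the source of `F` to `F`. -/
noncomputable def sourceIso (F : ComposableArrows C 1) [IsIso F.hom] :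
    ((isoRestrict C (SimplexCategory.σ (0 : Fin 1))).obj
      ((isoRestrict C (SimplexCategory.δ (1 : Fin 2))).obj (Core.mk F))).of ≅ F :=
  -- The components are the identity of the source and `F.hom` itself.
  ComposableArrows.isoMk₁ (Iso.refl F.left) (show F.left ≅ F.right from asIso F.hom) (by
    have e : CategoryTheory.Functor.map ((isoRestrict C (SimplexCategory.σ (0 : Fin 1))).obj
        ((isoRestrict C (SimplexCategory.δ (1 : Fin 2))).obj (Core.mk F))).of
        (homOfLE (Fin.zero_le (1 : Fin 2)) : (0 : Fin 2) ⟶ 1) = 𝟙 F.left := F.map_id 0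
    exact congrArg (· ≫ F.hom) e)

/-- Every isomorphism is isomorphic to the identity of its source. -/
noncomputable def sourceNatTrans : sourceOfIso C ⋙ degenerateIso C ⟶ 𝟭 (IsoArrow C) where
  app F := ObjectProperty.homMk ⟨haveI : IsIso F.obj.of.hom := F.property; sourceIso F.obj.of⟩
  naturality F G f := by
    apply ObjectProperty.hom_ext
    apply Core.hom_ext
    apply ComposableArrows.hom_ext₁
    · exact (Category.comp_id _).trans (Category.id_comp _).symm
    -- At the target, naturality is the commutative square that `f` is.
    · exact (f.hom.iso.hom.naturality (homOfLE (Fin.zero_le (1 : Fin 2)))).symm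

lemma isCompleteSegalSpace_classifyingDiagram : IsCompleteSegalSpace (classifyingDiagram C) where
  toIsSegalSpace := isSegalSpace_classifyingDiagram C
  complete := by
    refine ⟨nerveMap (degenerateIso C) ≫ (hoequivIso C).inv, rfl, ?_⟩
    refine isWeakEquivalence_of_deformation _
      ((hoequivIso C).hom ≫ nerveMap (sourceOfIso C)) ?_ ?_
    -- The source of an identity is the object itself: the simplicial identity `d_1 s_0 = id`.
    · exact (classifyingDiagram C).δ_comp_σ_succ (i := (0 : Fin 1))
    -- The natural transformation from the identity of the source gives the homotopy, transported
    -- along `hoequivIso`.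
    · have h := ((simpliciallyHomotopic_nerveMap (sourceNatTrans C)).precomp
        (hoequivIso C).hom).postcomp (hoequivIso C).inv
      have e : ((hoequivIso C).hom ≫ nerveMap (𝟭 (IsoArrow C))) ≫ (hoequivIso C).inv = 𝟙 _ :=
        (hoequivIso C).hom_inv_id
      rw [e] at h
      exact h

end Completeness

end RezkSpace

theorem mainTheorem10 (C : Type u) [Category.{v} C] :
    RezkSpace.IsCompleteSegalSpace (RezkSpace.classifyingDiagram C) :=
  RezkSpace.isCompleteSegalSpace_classifyingDiagram C
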